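/- Fix a support size $k\ge 2$. For a distribution $\mathbf p=(p_1,\dots,p_k)$ on $[k]$ let $C(\mathbf p)=\sum_i p_i^2$ be its collision probability. A mechanism with $n$ users is an interactive protocol between a server and $n$ users, user $i$ holding one private sample $x_i\in[k]$. The number of messages is finite, and every message becomes part of the transcript. Who sends the next message is determined by the transcript so far; a message of the server is random with a law depending only on the transcript so far, and a message of user $i$ is random with a law depending only on the transcript so far and on $x_i$ (messages take values in a standard Borel space). The mechanism $M$ is $(\alpha,0)$-locally differentially private if, for all samples $x_1,\dots,x_n$, every user $i$, every $x_i'$ and every measurable set $\mathcal O$ of transcripts, $$\Pr[M(x_1,\dots,x_n)\in\mathcal O]\le e^{\alpha}\,\Pr[M(x_1,\dots,x_{i-1},x_i',x_{i+1},\dots,x_n)\in\mathcal O].$$ Theorem. For every $\theta\in(0,1)$ there is a constant $c>0$, depending only on $\theta$, such that the following holds. Let $k\ge 2$, $n\ge 0$, $0\le\alpha\le\frac{23}{35}$, $0<\varepsilon\le\frac{\theta}{2}\left(1-\frac1k\right)$ and $n\,\alpha^2\varepsilon^2\le c$ (for $\alpha>0$: $n\le \frac{c}{\alpha^2\varepsilon^2}$).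 Let $\hat C_{\alpha,n}(\mathbf p)$ be any real-valued measurable function of the transcript of an $(\alpha,0)$-locally differentially private mechanism with $n$ users whose samples are drawn independently from $\mathbf p$. Then there is a distribution $\mathbf p$ on $[k]$ such that $$\mathbb E\left[\,\left|\hat C_{\alpha,n}(\mathbf p)-C(\mathbf p)\right|\,\right]\ge\varepsilon .$$ In particular, if along a sequence of parameters with $\varepsilon\le\frac{\theta}{2}\left(1-\frac1k\right)$ one has $n=o\left(\frac{1}{\alpha^2\varepsilon^2}\right)$, then eventually the expected error is at least $\varepsilon$ on some distribution. -/

import Mathlib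

open MeasureTheory ProbabilityTheory

/-- A (fully interactive) communication protocol between a server and `n` users, where user `i`
holds a single private sample in `Fin k`. Messages take values in the measurable space `Y`, and
everything that is sent becomes part of the transcript. In round `t` the messages sent so far,
`h : Fin t → Y`, determine who speaks: the server (`none`) or a user (`some i`). The server's
message is random with a law that depends only on `h`; the message of user `i` is random with a law
that depends only on `h` and on the sample of user `i`. The fresh randomness used in different
rounds is independent. Non-interactive mechanisms, with or without a public random string sent by
the server, are the special case in which every user speaks once and the law of the message ignores
the messages of the other users. -/
structure LocalProtocol (n k : ℕ) (Y : Type*) [MeasurableSpace Y] where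
  /-- the number of messages sent -/
  rounds : ℕ
  /-- who sends the message number `t`, given the previous messages -/
  speaker : (t : ℕ) → (Fin t → Y) → Option (Fin n)
  measurableSet_speaker : ∀ t o, MeasurableSet {h : Fin t → Y | speaker t h = o}
  /-- the law of the message of the server, given the previous messages -/
  server : (t : ℕ) → Kernel (Fin t → Y) Y
  isMarkovKernel_server : ∀ t, IsMarkovKernel (server t)
  /-- the law of the message of user `i`, given the user's sample and the previous messages -/
  user : Fin n → (t : ℕ) → Fin k → Kernel (Fin t → Y) Y
  isMarkovKernel_user : ∀ i t a, IsMarkovKernel (user i t a)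

namespace LocalProtocol

variable {n k : ℕ} {Y : Type*} [MeasurableSpace Y]

/-- The law of message number `t` given the previous messages, when the samples of the users are
`x`. -/
noncomputable def step (P : LocalProtocol n k Y) (x : Fin n → Fin k) (t : ℕ) :
    Kernel (Fin t → Y) Y where
  toFun h := match P.speaker t h with
    | none => P.server t h
    | some i => P.user i t (x i) h
  measurable' := by
    let _ : MeasurableSpace (Option (Fin n)) := ⊤
    have hs : Measurable (P.speaker t) :=
      measurable_to_countable' fun o => P.measurableSet_speaker t o
    have hg : Measurable fun q : Option (Fin n) × (Fin t → Y) =>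
        (match q.1 with
          | none => P.server t q.2
          | some i => P.user i t (x i) q.2 : Measure Y) := by
      refine measurable_from_prod_countable_right fun o => ?_
      cases o with
      | none => exact (P.server t).measurable
      | some i => exact (P.user i t (x i)).measurable
    exact hg.comp (hs.prodMk measurable_id)

/-- The law of the first `t` messages when the samples of the users are `x`. -/
noncomputable def prefixLaw (P : LocalProtocol n k Y) (x : Fin n → Fin k) :
    (t : ℕ) → Measure (Fin t → Y)
  | 0 => Measure.dirac Fin.elim0
  | t + 1 => (prefixLaw P x t ⊗ₘ P.step x t).map
      fun q => (Fin.snoc q.1 q.2 : Fin (t + 1) → Y)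

/-- The law of the whole transcript when the samples of the users are `x`. -/
noncomputable def transcriptLaw (P : LocalProtocol n k Y) (x : Fin n → Fin k) :
    Measure (Fin P.rounds → Y) :=
  P.prefixLaw x P.rounds

/-- `(α, β)`-local differential privacy: changing the sample of a single user changes the
probability of any event about the transcript by at most a factor `e ^ α` and an additive `β`. -/
def IsLDP (P : LocalProtocol n k Y) (α β : ℝ) : Prop :=
  ∀ (x : Fin n → Fin k) (i : Fin n) (a : Fin k) (O : Set (Fin P.rounds → Y)), MeasurableSet O →
    P.transcriptLaw x O ≤
      ENNReal.ofReal (Real.exp α) * P.transcriptLaw (Function.update x i a) O + ENNReal.ofReal β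

end LocalProtocol

/-- The collision probability of the distribution `p`. -/
def collisionProb {k : ℕ} (p : Fin k → ℝ) : ℝ := ∑ a, p a ^ 2

/-- The expected absolute error `E |Ĉ - C(p)|` of the estimate `Ĉ` of the collision probability that
is computed from the transcript, when the users draw their samples independently from `p`. It takes
values in `[0, ∞]`. -/
noncomputable def expectedError {n k : ℕ} {Y : Type*} [MeasurableSpace Y]
    (P : LocalProtocol n k Y) (est : (Fin P.rounds → Y) → ℝ) (p : Fin k → ℝ) : ENNReal :=
  ∑ x : Fin n → Fin k, ENNReal.ofReal (∏ i, p (x i)) *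
    ∫⁻ h, ENNReal.ofReal |est h - collisionProb p| ∂(P.transcriptLaw x)

/-!
Two-point method: compare the point mass at `a₀` with the point `q` of the segment from it to the
uniform distribution at which `collisionProb q = 1 - 2 * ε / θ`. As `q a₀` is the largest weight of
`q`, it is at least `collisionProb q`, so `q` moves at most the mass `2 * ε / θ` away from `a₀`.

By the rectangle property of interactive protocols, the law of the transcript under `q` has density
`∏ i, r i` with respect to its law under the point mass, where `r i` averages over `q` the
likelihood ratios that come from changing the sample of user `i` alone. The `r i` are not
independent, but the logarithm turns the product into a sum, so the relative entropy is at most the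
sum of the `-𝔼 log (r i)`. Privacy bounds each of these by `((2 * ε / θ) * (exp α - 1)) ^ 2`. Hence
`𝔼 min 1 (∏ i, r i) ≥ θ`, and by the triangle inequality the two expected errors add up to at least
`(2 * ε / θ) * θ = 2 * ε`.
-/

open scoped ENNReal

/-! ### Relative entropy and affinity -/

theorem sq_one_sub_min_one_le {R : ℝ} (hR : 0 < R) :
    (1 - min 1 R) ^ 2 ≤ 2 * (R - 1 - Real.log R) := by
  rcases le_total 1 R with h1 | h1
  · rw [min_eq_left h1]
    linarith [Real.log_le_sub_one_of_pos hR]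
  · rw [min_eq_right h1]
    have hlog : 2 * (1 - R) / (1 + R) ≤ -Real.log R := by
      have h := Real.le_log_one_add_of_nonneg (sub_nonneg.2 (one_le_inv₀ hR |>.2 h1))
      rw [add_sub_cancel, Real.log_inv] at h
      convert h using 1
      field_simp
      ring
    have hsq : (1 - R) ^ 2 / (1 + R) = 2 * (1 - R) / (1 + R) - (1 - R) := by field_simp; ring
    have hhalf : (1 - R) ^ 2 / 2 ≤ (1 - R) ^ 2 / (1 + R) := by gcongr; linarith
    linarith

theorem sub_one_sub_le_log {r D : ℝ} (hr : 0 < r) (hD : (r - 1) ^ 2 ≤ D * r) :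
    r - 1 - D ≤ Real.log r := by
  have h : (r - 1) ^ 2 / r ≤ D := (div_le_iff₀ hr).2 hD
  have hinv : 1 - r⁻¹ = r - 1 - (r - 1) ^ 2 / r := by field_simp; ring
  linarith [Real.one_sub_inv_le_log_of_pos hr]

section Affinity

variable {Ω : Type*} [MeasurableSpace Ω] {μ : Measure Ω} [IsProbabilityMeasure μ]

theorem sq_integral_le_integral_sq {f : Ω → ℝ} (hf : MemLp f 2 μ) :
    (∫ ω, f ω ∂μ) ^ 2 ≤ ∫ ω, f ω ^ 2 ∂μ := by
  have h := variance_nonneg f μ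
  rw [variance_eq_sub hf] at h
  simpa using h

theorem one_sub_sqrt_le_integral_min_one {R : Ω → ℝ} (hpos : ∀ᵐ ω ∂μ, 0 < R ω)
    (hint : Integrable R μ) (hone : ∫ ω, R ω ∂μ = 1)
    (hlog : Integrable (fun ω => Real.log (R ω)) μ) :
    1 - √(2 * -∫ ω, Real.log (R ω) ∂μ) ≤ ∫ ω, min 1 (R ω) ∂μ := by
  have hmin : Integrable (fun ω => min 1 (R ω)) μ := (integrable_const 1).inf hint
  have hsub : Integrable (fun ω => R ω - 1) μ := hint.sub (integrable_const 1)
  have hbdd : ∀ᵐ ω ∂μ, ‖1 - min 1 (R ω)‖ ≤ 1 := by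
    filter_upwards [hpos] with ω hω
    rw [Real.norm_of_nonneg (sub_nonneg.2 (min_le_left _ _))]
    linarith [le_min zero_le_one hω.le]
  have hL2 : MemLp (fun ω => 1 - min 1 (R ω)) 2 μ :=
    .of_bound (aestronglyMeasurable_const.sub hmin.1) 1 hbdd
  have hsq : (1 - ∫ ω, min 1 (R ω) ∂μ) ^ 2 ≤ 2 * -∫ ω, Real.log (R ω) ∂μ := by
    calc (1 - ∫ ω, min 1 (R ω) ∂μ) ^ 2 = (∫ ω, (1 - min 1 (R ω)) ∂μ) ^ 2 := by
          rw [integral_sub (integrable_const 1) hmin]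
          simp
      _ ≤ ∫ ω, (1 - min 1 (R ω)) ^ 2 ∂μ := sq_integral_le_integral_sq hL2
      _ ≤ ∫ ω, 2 * (R ω - 1 - Real.log (R ω)) ∂μ := by
          refine integral_mono_ae hL2.integrable_sq
            ((hsub.sub hlog).const_mul 2) ?_
          filter_upwards [hpos] with ω hω using sq_one_sub_min_one_le hω
      _ = 2 * -∫ ω, Real.log (R ω) ∂μ := by
          rw [integral_const_mul, integral_sub hsub hlog,
            integral_sub hint (integrable_const 1), hone]
          simp
  linarith [Real.le_sqrt_of_sq_le hsq]

theorem integrable_log_of_sq_sub_one_le {r : Ω → ℝ} {D : ℝ} (hint : Integrable r μ)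
    (hr : ∀ᵐ ω ∂μ, 0 < r ω ∧ (r ω - 1) ^ 2 ≤ D * r ω) :
    Integrable (fun ω => Real.log (r ω)) μ := by
  refine ((hint.sub (integrable_const 1)).abs.add (integrable_const D)).mono'
    (Real.measurable_log.comp_aemeasurable hint.aemeasurable).aestronglyMeasurable ?_
  filter_upwards [hr] with ω ⟨hpos, hsq⟩
  have hlow := sub_one_sub_le_log hpos hsq
  have hup := Real.log_le_sub_one_of_pos hpos
  refine abs_le.2 ⟨?_, ?_⟩ <;> simp only [Pi.add_apply, Pi.sub_apply] <;>
    linarith [neg_abs_le (r ω - 1), le_abs_self (r ω - 1)]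

theorem neg_integral_log_le {r : Ω → ℝ} {D : ℝ} (hint : Integrable r μ) (hone : ∫ ω, r ω ∂μ = 1)
    (hr : ∀ᵐ ω ∂μ, 0 < r ω ∧ (r ω - 1) ^ 2 ≤ D * r ω) : -∫ ω, Real.log (r ω) ∂μ ≤ D := by
  have hsub : Integrable (fun ω => r ω - 1) μ := hint.sub (integrable_const 1)
  have hlow : ∫ ω, (r ω - 1 - D) ∂μ ≤ ∫ ω, Real.log (r ω) ∂μ := by
    refine integral_mono_ae (hsub.sub (integrable_const D))
      (integrable_log_of_sq_sub_one_le hint hr) ?_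
    filter_upwards [hr] with ω hω using sub_one_sub_le_log hω.1 hω.2
  rw [integral_sub hsub (integrable_const D), integral_sub hint (integrable_const 1), hone] at hlow
  simp only [integral_const, probReal_univ, one_smul] at hlow
  linarith

theorem one_sub_sqrt_le_integral_min_one_prod {ι : Type*} [Fintype ι] {r : ι → Ω → ℝ} {D : ι → ℝ}
    (hint : ∀ i, Integrable (r i) μ) (hone : ∀ i, ∫ ω, r i ω ∂μ = 1)
    (hr : ∀ i, ∀ᵐ ω ∂μ, 0 < r i ω ∧ (r i ω - 1) ^ 2 ≤ D i * r i ω)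
    (hprod : Integrable (fun ω => ∏ i, r i ω) μ) (hprod_one : ∫ ω, ∏ i, r i ω ∂μ = 1) :
    1 - √(2 * ∑ i, D i) ≤ ∫ ω, min 1 (∏ i, r i ω) ∂μ := by
  have hlog : ∀ i, Integrable (fun ω => Real.log (r i ω)) μ := fun i =>
    integrable_log_of_sq_sub_one_le (hint i) (hr i)
  have hlog_prod : (fun ω => Real.log (∏ i, r i ω)) =ᵐ[μ] fun ω => ∑ i, Real.log (r i ω) := by
    filter_upwards [ae_all_iff.2 hr] with ω hω using Real.log_prod fun i _ => (hω i).1.ne'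
  have hpos : ∀ᵐ ω ∂μ, 0 < ∏ i, r i ω := by
    filter_upwards [ae_all_iff.2 hr] with ω hω using Finset.prod_pos fun i _ => (hω i).1
  have hle : -∫ ω, Real.log (∏ i, r i ω) ∂μ ≤ ∑ i, D i := by
    rw [integral_congr_ae hlog_prod, integral_finsetSum _ fun i _ => hlog i,
      ← Finset.sum_neg_distrib]
    exact Finset.sum_le_sum fun i _ => neg_integral_log_le (hint i) (hone i) (hr i)
  calc 1 - √(2 * ∑ i, D i) ≤ 1 - √(2 * -∫ ω, Real.log (∏ i, r i ω) ∂μ) := by gcongr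
    _ ≤ ∫ ω, min 1 (∏ i, r i ω) ∂μ := one_sub_sqrt_le_integral_min_one hpos hprod hprod_one
        ((integrable_finsetSum _ fun i _ => hlog i).congr hlog_prod.symm)

end Affinity

theorem edist_mul_lintegral_min_one_le {Ω X : Type*} [MeasurableSpace Ω] [PseudoEMetricSpace X]
    [MeasurableSpace X] [OpensMeasurableSpace X]
    (μ : Measure Ω) {ρ : Ω → ℝ≥0∞} (hρ : Measurable ρ) {f : Ω → X} (hf : Measurable f) (a b : X) :
    edist a b * ∫⁻ ω, min 1 (ρ ω) ∂μ ≤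
      ∫⁻ ω, edist (f ω) a ∂μ + ∫⁻ ω, edist (f ω) b ∂(μ.withDensity ρ) := by
  have hdist : ∀ c, Measurable fun ω => edist (f ω) c := fun c =>
    measurable_edist_left.comp hf
  calc edist a b * ∫⁻ ω, min 1 (ρ ω) ∂μ = ∫⁻ ω, edist a b * min 1 (ρ ω) ∂μ :=
        (lintegral_const_mul _ (measurable_const.min hρ)).symm
    _ ≤ ∫⁻ ω, (edist (f ω) a + ρ ω * edist (f ω) b) ∂μ := by
        refine lintegral_mono fun ω => ?_
        calc edist a b * min 1 (ρ ω) ≤ (edist (f ω) a + edist (f ω) b) * min 1 (ρ ω) := by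
              gcongr
              exact edist_triangle_left a b (f ω)
          _ = edist (f ω) a * min 1 (ρ ω) + min 1 (ρ ω) * edist (f ω) b := by
              rw [add_mul, mul_comm (edist (f ω) b)]
          _ ≤ edist (f ω) a * 1 + ρ ω * edist (f ω) b := by
              gcongr
              · exact min_le_left _ _
              · exact min_le_right _ _
          _ = edist (f ω) a + ρ ω * edist (f ω) b := by rw [mul_one]
    _ = ∫⁻ ω, edist (f ω) a ∂μ + ∫⁻ ω, edist (f ω) b ∂(μ.withDensity ρ) := by
        rw [lintegral_add_left (hdist a), lintegral_withDensity_eq_lintegral_mul _ hρ (hdist b)]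
        rfl

/-! ### Rectangular families of measures -/

theorem withDensity_compProd_left {Ω Y : Type*} [MeasurableSpace Ω] [MeasurableSpace Y]
    (μ : Measure Ω) [SFinite μ] (κ : Kernel Ω Y) [IsSFiniteKernel κ] {f : Ω → ℝ≥0∞}
    (hf : Measurable f) :
    μ.withDensity f ⊗ₘ κ = (μ ⊗ₘ κ).withDensity fun q => f q.1 := by
  ext s hs
  have hfs : Measurable (s.indicator fun q : Ω × Y => f q.1) :=
    (hf.comp measurable_fst).indicator hs
  rw [Measure.compProd_apply hs, withDensity_apply _ hs, ← lintegral_indicator hs,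
    Measure.lintegral_compProd hfs,
    lintegral_withDensity_eq_lintegral_mul _ hf (Kernel.measurable_kernel_prodMk_left hs)]
  refine lintegral_congr fun ω => ?_
  have hsω : MeasurableSet (Prod.mk ω ⁻¹' s) := measurable_prodMk_left hs
  rw [Pi.mul_apply, ← lintegral_indicator_one hsω,
    ← lintegral_const_mul _ (measurable_one.indicator hsω)]
  refine lintegral_congr fun y => ?_
  by_cases hy : (ω, y) ∈ s <;> simp [Set.indicator, hy]

theorem map_withDensity_comp {Ω Ω' : Type*} [MeasurableSpace Ω] [MeasurableSpace Ω']
    (μ : Measure Ω) {e : Ω → Ω'} (he : Measurable e) {f : Ω' → ℝ≥0∞} (hf : Measurable f) :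
    (μ.withDensity (f ∘ e)).map e = (μ.map e).withDensity f := by
  ext s hs
  rw [Measure.map_apply he hs, withDensity_apply _ (he hs), withDensity_apply _ hs,
    setLIntegral_map hs hf he]
  rfl

theorem restrict_compProd_congr {Ω Y : Type*} [MeasurableSpace Ω] [MeasurableSpace Y]
    (μ : Measure Ω) [SFinite μ] {κ η : Kernel Ω Y} [IsSFiniteKernel κ] [IsSFiniteKernel η]
    {s : Set Ω} (hs : MeasurableSet s) (h : ∀ ω ∈ s, κ ω = η ω) :
    (μ ⊗ₘ κ).restrict (Prod.fst ⁻¹' s) = (μ ⊗ₘ η).restrict (Prod.fst ⁻¹' s) := by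
  ext t ht
  have hts : MeasurableSet (t ∩ Prod.fst ⁻¹' s) := ht.inter (measurable_fst hs)
  rw [Measure.restrict_apply ht, Measure.restrict_apply ht, Measure.compProd_apply hts,
    Measure.compProd_apply hts]
  refine lintegral_congr fun ω => ?_
  by_cases hω : ω ∈ s
  · rw [h ω hω]
  · have hempty : Prod.mk ω ⁻¹' (t ∩ Prod.fst ⁻¹' s) = ∅ := by ext; simp [hω]
    rw [hempty, measure_empty, measure_empty]

section RnDeriv

variable {Ω : Type*} [MeasurableSpace Ω] {μ ν : Measure Ω} [SigmaFinite ν] {c : ℝ}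

theorem toReal_rnDeriv_le_of_le_smul (hc : 0 ≤ c) (h : μ ≤ ENNReal.ofReal c • ν) :
    ∀ᵐ ω ∂ν, (μ.rnDeriv ν ω).toReal ≤ c := by
  have hle : μ.rnDeriv ν ≤ᵐ[ν] fun _ => ENNReal.ofReal c := by
    refine ae_le_of_forall_setLIntegral_le_of_sigmaFinite (Measure.measurable_rnDeriv μ ν)
      fun s _ _ => ?_
    rw [setLIntegral_const]
    exact (Measure.setLIntegral_rnDeriv_le s).trans (h s)
  filter_upwards [hle] with ω hω using ENNReal.toReal_le_of_le_ofReal hc hω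

theorem inv_le_toReal_rnDeriv_of_le_smul [SigmaFinite μ] (hc : 0 < c) (hμν : μ ≪ ν)
    (h : ν ≤ ENNReal.ofReal c • μ) :
    ∀ᵐ ω ∂ν, c⁻¹ ≤ (μ.rnDeriv ν ω).toReal := by
  have hle : (fun _ => 1) ≤ᵐ[ν] fun ω => ENNReal.ofReal c * μ.rnDeriv ν ω := by
    refine ae_le_of_forall_setLIntegral_le_of_sigmaFinite measurable_const fun s _ _ => ?_
    rw [lintegral_const_mul _ (Measure.measurable_rnDeriv μ ν), Measure.setLIntegral_rnDeriv hμν,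
      setLIntegral_one]
    exact h s
  filter_upwards [hle, Measure.rnDeriv_ne_top μ ν] with ω hω htop
  rw [inv_le_iff_one_le_mul₀' hc]
  simpa [ENNReal.toReal_mul, hc.le] using
    ENNReal.toReal_mono (ENNReal.mul_ne_top ENNReal.ofReal_ne_top htop) hω

end RnDeriv

theorem ne_zero_and_ne_top_of_prod {ι : Type*} [Fintype ι] {f : ι → ℝ≥0∞} (h0 : ∏ i, f i ≠ 0)
    (htop : ∏ i, f i ≠ ∞) (i : ι) : f i ≠ 0 ∧ f i ≠ ∞ := by
  classical
  have hne := Finset.prod_ne_zero_iff.1 h0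
  refine ⟨hne i (Finset.mem_univ i), fun hi => htop ?_⟩
  rw [← Finset.mul_prod_erase _ _ (Finset.mem_univ i), hi]
  exact ENNReal.top_mul (Finset.prod_ne_zero_iff.2 fun j _ => hne j (Finset.mem_univ j))

section Rectangular

variable {Ω ι A : Type*} [MeasurableSpace Ω] [Fintype ι]

/-- The rectangle property of communication protocols: for a common finite reference measure, the
density of the law `m x` of the transcript on the inputs `x` is a product of factors, one for each
index `i`, which depends on `x` only through `x i`. -/
def IsRectangular (m : (ι → A) → Measure Ω) : Prop :=
  ∃ (μ : Measure Ω) (F : ι → A → Ω → ℝ≥0∞), IsFiniteMeasure μ ∧ (∀ i a, Measurable (F i a)) ∧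
    ∀ x, m x = μ.withDensity fun ω => ∏ i, F i (x i) ω

namespace IsRectangular

variable {m : (ι → A) → Measure Ω}

theorem const (ν : Measure Ω) [IsFiniteMeasure ν] : IsRectangular fun _ : ι → A => ν :=
  ⟨ν, fun _ _ _ => 1, inferInstance, fun _ _ => measurable_const, fun _ => by simp⟩

theorem of_apply [Finite A] (ν : A → Measure Ω) [∀ a, IsFiniteMeasure (ν a)] (i : ι) :
    IsRectangular fun x : ι → A => ν (x i) := by
  classical
  have := Fintype.ofFinite A
  have hac : ∀ a, ν a ≪ ∑ b, ν b := fun a => by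
    rw [← Measure.sum_fintype]
    exact Measure.absolutelyContinuous_sum_right a .rfl
  refine ⟨∑ b, ν b, fun j a => if j = i then (ν a).rnDeriv (∑ b, ν b) else 1,
    inferInstance, fun j a => ?_, fun x => ?_⟩
  · dsimp only
    split_ifs
    · exact Measure.measurable_rnDeriv _ _
    · exact measurable_const
  · dsimp only
    conv_lhs => rw [← Measure.withDensity_rnDeriv_eq _ _ (hac (x i))]
    congr with ω
    rw [Finset.prod_eq_single i (fun j _ hj => by rw [if_neg hj, Pi.one_apply]) (by simp),
      if_pos rfl]

theorem withDensity_prod (hm : IsRectangular m) {G : ι → A → Ω → ℝ≥0∞}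
    (hG : ∀ i a, Measurable (G i a)) :
    IsRectangular fun x => (m x).withDensity fun ω => ∏ i, G i (x i) ω := by
  obtain ⟨μ, F, hμ, hF, hmF⟩ := hm
  refine ⟨μ, fun i a ω => F i a ω * G i a ω, hμ, fun i a => (hF i a).mul (hG i a), fun x => ?_⟩
  simp only [hmF]
  rw [← withDensity_mul _ (Finset.measurable_fun_prod _ fun i _ => hF i (x i))
    (Finset.measurable_fun_prod _ fun i _ => hG i (x i))]
  simp only [Pi.mul_def, Finset.prod_mul_distrib]

theorem map {Ω' : Type*} [MeasurableSpace Ω'] (hm : IsRectangular m) (e : Ω ≃ᵐ Ω') :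
    IsRectangular fun x => (m x).map e := by
  obtain ⟨μ, F, hμ, hF, hmF⟩ := hm
  have hFe : ∀ i a, Measurable (F i a ∘ e.symm) := fun i a => (hF i a).comp e.symm.measurable
  refine ⟨μ.map e, fun i a => F i a ∘ e.symm, inferInstance, hFe, fun x => ?_⟩
  simp only [hmF]
  rw [← map_withDensity_comp μ e.measurable
    (Finset.measurable_fun_prod _ fun i _ => hFe i (x i))]
  simp [Function.comp_def]

theorem of_restrict_fiber {S : Type*} [Finite S] [MeasurableSpace S] [MeasurableSingletonClass S]
    {σ : Ω → S} (hσ : Measurable σ) {m' : S → (ι → A) → Measure Ω}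
    (hm' : ∀ s, IsRectangular (m' s))
    (hm : ∀ s x, (m x).restrict (σ ⁻¹' {s}) = (m' s x).restrict (σ ⁻¹' {s})) :
    IsRectangular m := by
  have := Fintype.ofFinite S
  choose μ F _ hF hmF using hm'
  have hfiber : ∀ s, MeasurableSet (σ ⁻¹' {s}) := fun s => hσ (measurableSet_singleton s)
  let ref : Measure Ω := Measure.sum fun s => (μ s).restrict (σ ⁻¹' {s})
  have href : ∀ s, ref.restrict (σ ⁻¹' {s}) = (μ s).restrict (σ ⁻¹' {s}) := fun s => by
    rw [Measure.restrict_sum _ (hfiber s), Measure.sum_fintype, Finset.sum_eq_single s]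
    · rw [Measure.restrict_restrict (hfiber s), Set.inter_self]
    · intro s' _ hs'
      have hdisj := ((Set.disjoint_singleton.2 hs'.symm).preimage σ).inter_eq
      rw [Measure.restrict_restrict (hfiber s), hdisj, Measure.restrict_empty]
    · simp
  have hfin : IsFiniteMeasure ref := by
    simp only [ref, Measure.sum_fintype]
    infer_instance
  refine ⟨ref, fun i a ω => F (σ ω) i a ω, hfin, fun i a => ?_, fun x => ?_⟩
  · have hjoint : Measurable fun q : S × Ω => F q.1 i a q.2 :=
      measurable_from_prod_countable_right fun s => hF s i a
    exact hjoint.comp (hσ.prodMk measurable_id)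
  · have hcover : ⋃ s, σ ⁻¹' {s} = Set.univ := by ext; simp
    refine (Measure.ext_iff_of_iUnion_eq_univ hcover).2 fun s => ?_
    rw [hm, hmF, restrict_withDensity (hfiber s), restrict_withDensity (hfiber s), href]
    refine withDensity_congr_ae ?_
    filter_upwards [ae_restrict_mem (hfiber s)] with ω hω
    rw [Set.mem_singleton_iff.1 hω]

theorem exists_eq_withDensity_of_absolutelyContinuous (hm : IsRectangular m) {x₀ : ι → A}
    [IsFiniteMeasure (m x₀)] (hac : ∀ x, m x ≪ m x₀) :
    ∃ G : ι → A → Ω → ℝ≥0∞, (∀ i a, Measurable (G i a)) ∧ (∀ᵐ ω ∂m x₀, ∀ i, G i (x₀ i) ω = 1) ∧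
      ∀ x, m x = (m x₀).withDensity fun ω => ∏ i, G i (x i) ω := by
  obtain ⟨μ, F, _, hF, hmF⟩ := hm
  have hprod : ∀ x : ι → A, Measurable fun ω => ∏ i, F i (x i) ω := fun x =>
    Finset.measurable_fun_prod _ fun i _ => hF i (x i)
  have hG : ∀ i a, Measurable fun ω => F i a ω / F i (x₀ i) ω := fun i a =>
    (hF i a).div (hF i (x₀ i))
  have htop : ∀ᵐ ω ∂μ, ∏ i, F i (x₀ i) ω ≠ ∞ := by
    refine (ae_lt_top (hprod x₀) ?_).mono fun ω => LT.lt.ne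
    rw [← setLIntegral_univ, ← withDensity_apply _ .univ, ← hmF]
    exact measure_ne_top _ _
  have hfac : ∀ᵐ ω ∂μ, ∏ i, F i (x₀ i) ω ≠ 0 → ∀ i, F i (x₀ i) ω ≠ 0 ∧ F i (x₀ i) ω ≠ ∞ :=
    htop.mono fun ω hω h0 => ne_zero_and_ne_top_of_prod h0 hω
  have hsupp : ∀ᵐ ω ∂m x₀, ∏ i, F i (x₀ i) ω ≠ 0 := by
    rw [hmF]
    exact (ae_withDensity_iff (hprod x₀)).2 (.of_forall fun _ => id)
  refine ⟨fun i a ω => F i a ω / F i (x₀ i) ω, hG, ?_, fun x => ?_⟩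
  · rw [hmF, ae_withDensity_iff (hprod x₀)]
    filter_upwards [hfac] with ω hω h0 i using ENNReal.div_self (hω h0 i).1 (hω h0 i).2
  · have hsuppx : ∀ᵐ ω ∂m x, ∏ i, F i (x₀ i) ω ≠ 0 := (hac x).ae_le hsupp
    rw [hmF, ae_withDensity_iff (hprod x)] at hsuppx
    rw [hmF x, hmF x₀, ← withDensity_mul _ (hprod x₀)
      (Finset.measurable_fun_prod _ fun i _ => hG i (x i))]
    refine withDensity_congr_ae ?_
    filter_upwards [hfac, hsuppx] with ω hω hωx
    by_cases h0 : ∏ i, F i (x₀ i) ω = 0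
    · rw [Pi.mul_apply, h0, zero_mul]
      exact not_imp_not.1 hωx h0
    · rw [Pi.mul_apply, ← Finset.prod_mul_distrib]
      exact Finset.prod_congr rfl fun i _ => (ENNReal.mul_div_cancel (hω h0 i).1 (hω h0 i).2).symm

theorem withDensity_prod_rnDeriv_update [DecidableEq ι] (hm : IsRectangular m) {x₀ : ι → A}
    [IsFiniteMeasure (m x₀)] (hac : ∀ x, m x ≪ m x₀) (x : ι → A) :
    (m x₀).withDensity (fun ω => ∏ i, (m (Function.update x₀ i (x i))).rnDeriv (m x₀) ω) = m x := by
  obtain ⟨G, hG, hone, hmG⟩ := hm.exists_eq_withDensity_of_absolutelyContinuous hac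
  have hderiv : ∀ i,
      (m (Function.update x₀ i (x i))).rnDeriv (m x₀) =ᵐ[m x₀] G i (x i) := fun i => by
    have hdens := Measure.rnDeriv_withDensity (m x₀)
      (Finset.measurable_fun_prod Finset.univ fun j _ => hG j (Function.update x₀ i (x i) j))
    rw [← hmG] at hdens
    filter_upwards [hdens, hone] with ω hω hω1
    rw [hω, Finset.prod_eq_single i (fun j _ hj => by rw [Function.update_of_ne hj, hω1 j])
      (by simp), Function.update_self]
  rw [hmG x]
  refine withDensity_congr_ae ?_
  filter_upwards [ae_all_iff.2 hderiv] with ω hω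
  exact Finset.prod_congr rfl fun i _ => hω i

end IsRectangular

end Rectangular

/-! ### Mixtures over independent inputs -/

theorem absolutelyContinuous_of_le_smul_update {Ω ι A : Type*} [MeasurableSpace Ω] [Finite ι]
    [DecidableEq ι] {m : (ι → A) → Measure Ω} {c : ℝ≥0∞}
    (h : ∀ x i a, m x ≤ c • m (Function.update x i a)) (x y : ι → A) : m x ≪ m y := by
  have := Fintype.ofFinite ι
  have hpiece : ∀ s : Finset ι, m x ≪ m (s.piecewise y x) := fun s => by
    induction s using Finset.induction with
    | empty => rw [Finset.piecewise_empty]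
    | insert i s _ ih =>
      rw [Finset.piecewise_insert]
      exact ih.trans (Measure.absolutelyContinuous_of_le_smul (h _ _ _))
  simpa using hpiece Finset.univ

theorem sq_sub_one_le_sq_mul {r δ E : ℝ} (hE : 1 ≤ E) (hlow : E⁻¹ ≤ r)
    (hdown : 1 - r ≤ δ * E⁻¹) (hup : r - 1 ≤ δ) : (r - 1) ^ 2 ≤ δ ^ 2 * r := by
  rcases le_total 1 r with h1 | h1
  · calc (r - 1) ^ 2 ≤ δ ^ 2 := by gcongr
      _ ≤ δ ^ 2 * r := le_mul_of_one_le_right (sq_nonneg δ) h1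
  · have hinv : E⁻¹ * E⁻¹ ≤ E⁻¹ * 1 := by gcongr; exact inv_le_one_of_one_le₀ hE
    calc (r - 1) ^ 2 = (1 - r) ^ 2 := by ring
      _ ≤ (δ * E⁻¹) ^ 2 := by gcongr
      _ = δ ^ 2 * (E⁻¹ * E⁻¹) := by ring
      _ ≤ δ ^ 2 * r := by gcongr; linarith

theorem sum_mul_pos_and_sq_sub_one_le {A : Type*} [Fintype A] {q ρ : A → ℝ}
    (hq : q ∈ stdSimplex ℝ A) {E : ℝ} (hE : 1 ≤ E) (hρ : ∀ a, ρ a ∈ Set.Icc E⁻¹ E) {a₀ : A}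
    (h₀ : ρ a₀ = 1) :
    0 < ∑ a, q a * ρ a ∧
      (∑ a, q a * ρ a - 1) ^ 2 ≤ ((1 - q a₀) * (E - 1)) ^ 2 * ∑ a, q a * ρ a := by
  classical
  have hE0 : 0 < E := one_pos.trans_le hE
  have hγ : ∑ a ∈ Finset.univ.erase a₀, q a = 1 - q a₀ := by
    rw [Finset.sum_erase_eq_sub (Finset.mem_univ a₀), hq.2]
  have hsub : ∑ a, q a * ρ a - 1 = ∑ a ∈ Finset.univ.erase a₀, q a * (ρ a - 1) := by
    rw [Finset.sum_erase _ (by rw [h₀, sub_self, mul_zero])]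
    simp only [mul_sub, mul_one, Finset.sum_sub_distrib, hq.2]
  have hlow : E⁻¹ ≤ ∑ a, q a * ρ a := by
    calc E⁻¹ = ∑ a, q a * E⁻¹ := by rw [← Finset.sum_mul, hq.2, one_mul]
      _ ≤ ∑ a, q a * ρ a := Finset.sum_le_sum fun a _ =>
          mul_le_mul_of_nonneg_left (hρ a).1 (hq.1 a)
  have hup : ∑ a, q a * ρ a - 1 ≤ (1 - q a₀) * (E - 1) := by
    rw [hsub, ← hγ, Finset.sum_mul]
    exact Finset.sum_le_sum fun a _ =>
      mul_le_mul_of_nonneg_left (sub_le_sub_right (hρ a).2 1) (hq.1 a)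
  have hdown : (1 - q a₀) * (E⁻¹ - 1) ≤ ∑ a, q a * ρ a - 1 := by
    rw [hsub, ← hγ, Finset.sum_mul]
    exact Finset.sum_le_sum fun a _ =>
      mul_le_mul_of_nonneg_left (sub_le_sub_right (hρ a).1 1) (hq.1 a)
  refine ⟨(inv_pos.2 hE0).trans_le hlow, sq_sub_one_le_sq_mul hE hlow ?_ hup⟩
  calc 1 - ∑ a, q a * ρ a ≤ (1 - q a₀) * (1 - E⁻¹) := by linarith
    _ = (1 - q a₀) * (E - 1) * E⁻¹ := by field_simp

section Mixture

variable {Ω ι A : Type*} [MeasurableSpace Ω] [DecidableEq ι] [Fintype A]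

/-- The likelihood ratio, against the output law `m x₀` of the channel `m`, of its output law when
the input with index `i` is drawn from `q` instead of being `x₀ i`. -/
noncomputable def inputRatio (m : (ι → A) → Measure Ω) (x₀ : ι → A) (i : ι) (q : A → ℝ) (ω : Ω) :
    ℝ :=
  ∑ a, q a * ((m (Function.update x₀ i a)).rnDeriv (m x₀) ω).toReal

variable {m : (ι → A) → Measure Ω}

theorem measurable_inputRatio (x₀ : ι → A) (i : ι) (q : A → ℝ) :
    Measurable (inputRatio m x₀ i q) :=
  Finset.measurable_fun_sum _ fun _ _ => (Measure.measurable_rnDeriv _ _).ennreal_toReal.const_mul _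

theorem integrable_inputRatio [∀ x, IsFiniteMeasure (m x)] (x₀ : ι → A) (i : ι) (q : A → ℝ) :
    Integrable (inputRatio m x₀ i q) (m x₀) :=
  integrable_finsetSum _ fun _ _ => Measure.integrable_toReal_rnDeriv.const_mul _

theorem integral_inputRatio [∀ x, IsProbabilityMeasure (m x)] {x₀ : ι → A}
    (hac : ∀ x, m x ≪ m x₀) (i : ι) {q : A → ℝ} (hq : ∑ a, q a = 1) :
    ∫ ω, inputRatio m x₀ i q ω ∂m x₀ = 1 := by
  simp only [inputRatio]
  rw [integral_finsetSum _ fun _ _ => Measure.integrable_toReal_rnDeriv.const_mul _]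
  simp only [integral_const_mul, Measure.integral_toReal_rnDeriv (hac _), probReal_univ,
    mul_one, hq]

theorem inputRatio_pos_and_sq_sub_one_le [Finite ι] [∀ x, IsFiniteMeasure (m x)] {E : ℝ}
    (hE : 1 ≤ E) (hpriv : ∀ x i a, m x ≤ ENNReal.ofReal E • m (Function.update x i a))
    (x₀ : ι → A) (i : ι) {q : A → ℝ} (hq : q ∈ stdSimplex ℝ A) :
    ∀ᵐ ω ∂m x₀, 0 < inputRatio m x₀ i q ω ∧ (inputRatio m x₀ i q ω - 1) ^ 2 ≤
      ((1 - q (x₀ i)) * (E - 1)) ^ 2 * inputRatio m x₀ i q ω := by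
  have hE0 : 0 < E := one_pos.trans_le hE
  have hmem : ∀ a, ∀ᵐ ω ∂m x₀,
      ((m (Function.update x₀ i a)).rnDeriv (m x₀) ω).toReal ∈ Set.Icc E⁻¹ E := fun a => by
    have hback : m (Function.update x₀ i a) ≤ ENNReal.ofReal E • m x₀ := by
      simpa using hpriv (Function.update x₀ i a) i (x₀ i)
    exact (inv_le_toReal_rnDeriv_of_le_smul hE0 (absolutelyContinuous_of_le_smul_update hpriv _ _)
      (hpriv x₀ i a)).and (toReal_rnDeriv_le_of_le_smul hE0.le hback)
  have hself : ∀ᵐ ω ∂m x₀,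
      ((m (Function.update x₀ i (x₀ i))).rnDeriv (m x₀) ω).toReal = 1 := by
    rw [Function.update_eq_self]
    filter_upwards [Measure.rnDeriv_self (m x₀)] with ω hω
    rw [hω, ENNReal.toReal_one]
  filter_upwards [ae_all_iff.2 hmem, hself] with ω hω hω₀
  exact sum_mul_pos_and_sq_sub_one_le hq hE hω hω₀

variable [Fintype ι]

/-- The law of the output of the channel `m` when the inputs are drawn independently, the one with
index `i` from the distribution `q i`. -/
noncomputable def productMixture (m : (ι → A) → Measure Ω) (q : ι → A → ℝ) : Measure Ω :=
  ∑ x, ENNReal.ofReal (∏ i, q i (x i)) • m x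

theorem productMixture_single [DecidableEq A] (x₀ : ι → A) :
    productMixture m (fun i => Pi.single (x₀ i) 1) = m x₀ := by
  rw [productMixture, Finset.sum_eq_single x₀]
  · simp
  · intro x _ hx
    obtain ⟨i, hi⟩ := Function.ne_iff.1 hx
    rw [Finset.prod_eq_zero (Finset.mem_univ i) (Pi.single_eq_of_ne hi 1), ENNReal.ofReal_zero,
      zero_smul]
  · simp

theorem lintegral_productMixture (q : ι → A → ℝ) (f : Ω → ℝ≥0∞) :
    ∫⁻ ω, f ω ∂productMixture m q =
      ∑ x, ENNReal.ofReal (∏ i, q i (x i)) * ∫⁻ ω, f ω ∂m x := by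
  simp only [productMixture, lintegral_finsetSum_measure, lintegral_smul_measure, smul_eq_mul]

theorem productMixture_univ [∀ x, IsProbabilityMeasure (m x)] {q : ι → A → ℝ}
    (hq : ∀ i, q i ∈ stdSimplex ℝ A) : productMixture m q Set.univ = 1 := by
  rw [← setLIntegral_one, setLIntegral_univ, lintegral_productMixture]
  simp only [lintegral_one, measure_univ, mul_one]
  rw [← ENNReal.ofReal_sum_of_nonneg fun x _ => Finset.prod_nonneg fun i _ => (hq i).1 (x i),
    ← Fintype.prod_sum]
  simp only [(hq _).2, Finset.prod_const_one, ENNReal.ofReal_one]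

theorem IsRectangular.productMixture_eq_withDensity (hm : IsRectangular m) {x₀ : ι → A}
    [∀ x, IsFiniteMeasure (m x)] (hac : ∀ x, m x ≪ m x₀) {q : ι → A → ℝ} (hq : ∀ i a, 0 ≤ q i a) :
    productMixture m q =
      (m x₀).withDensity fun ω => ENNReal.ofReal (∏ i, inputRatio m x₀ i (q i) ω) := by
  have hprod : ∀ x : ι → A,
      Measurable fun ω => ∏ i, (m (Function.update x₀ i (x i))).rnDeriv (m x₀) ω := fun x =>
    Finset.measurable_fun_prod _ fun i _ => Measure.measurable_rnDeriv _ _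
  have hfin : ∀ᵐ ω ∂m x₀, ∀ i a, (m (Function.update x₀ i a)).rnDeriv (m x₀) ω ≠ ∞ :=
    ae_all_iff.2 fun i => ae_all_iff.2 fun a => Measure.rnDeriv_ne_top _ _
  ext s hs
  rw [withDensity_apply _ hs]
  simp only [productMixture, Measure.coe_finsetSum, Finset.sum_apply, Measure.smul_apply,
    smul_eq_mul]
  calc ∑ x : ι → A, ENNReal.ofReal (∏ i, q i (x i)) * m x s
      = ∑ x : ι → A, ∫⁻ ω in s, ENNReal.ofReal (∏ i, q i (x i)) *
          ∏ i, (m (Function.update x₀ i (x i))).rnDeriv (m x₀) ω ∂m x₀ := by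
        refine Finset.sum_congr rfl fun x _ => ?_
        rw [lintegral_const_mul _ (hprod x), ← withDensity_apply _ hs,
          hm.withDensity_prod_rnDeriv_update hac]
    _ = ∫⁻ ω in s, ∑ x : ι → A, ENNReal.ofReal (∏ i, q i (x i)) *
          ∏ i, (m (Function.update x₀ i (x i))).rnDeriv (m x₀) ω ∂m x₀ :=
        (lintegral_finsetSum _ fun x _ => (hprod x).const_mul _).symm
    _ = ∫⁻ ω in s, ENNReal.ofReal (∏ i, inputRatio m x₀ i (q i) ω) ∂m x₀ := by
        refine lintegral_congr_ae (ae_restrict_of_ae ?_)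
        filter_upwards [hfin] with ω hω
        simp only [inputRatio]
        rw [Fintype.prod_sum, ENNReal.ofReal_sum_of_nonneg fun x _ => Finset.prod_nonneg fun i _ =>
          mul_nonneg (hq i _) ENNReal.toReal_nonneg]
        refine Finset.sum_congr rfl fun x _ => ?_
        rw [Finset.prod_mul_distrib, ENNReal.ofReal_mul (Finset.prod_nonneg fun i _ => hq i _),
          ENNReal.ofReal_prod_of_nonneg (f := fun i => ENNReal.toReal _) fun i _ =>
            ENNReal.toReal_nonneg]
        simp only [ENNReal.ofReal_toReal (hω _ _)]

theorem IsRectangular.ofReal_one_sub_sqrt_le_lintegral_min_one (hm : IsRectangular m)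
    [∀ x, IsProbabilityMeasure (m x)] {E : ℝ} (hE : 1 ≤ E)
    (hpriv : ∀ x i a, m x ≤ ENNReal.ofReal E • m (Function.update x i a)) (x₀ : ι → A)
    {q : ι → A → ℝ} (hq : ∀ i, q i ∈ stdSimplex ℝ A) :
    ENNReal.ofReal (1 - √(2 * ∑ i, ((1 - q i (x₀ i)) * (E - 1)) ^ 2)) ≤
      ∫⁻ ω, min 1 (ENNReal.ofReal (∏ i, inputRatio m x₀ i (q i) ω)) ∂m x₀ := by
  have hac := fun x => absolutelyContinuous_of_le_smul_update hpriv x x₀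
  have hr := fun i => inputRatio_pos_and_sq_sub_one_le hE hpriv x₀ i (hq i)
  have hnonneg : 0 ≤ᵐ[m x₀] fun ω => ∏ i, inputRatio m x₀ i (q i) ω := by
    filter_upwards [ae_all_iff.2 hr] with ω hω using Finset.prod_nonneg fun i _ => (hω i).1.le
  have hmeas : AEStronglyMeasurable (fun ω => ∏ i, inputRatio m x₀ i (q i) ω) (m x₀) :=
    (Finset.measurable_fun_prod _ fun i _ => measurable_inputRatio x₀ i (q i)).aestronglyMeasurable
  have hmass : ∫⁻ ω, ENNReal.ofReal (∏ i, inputRatio m x₀ i (q i) ω) ∂m x₀ = 1 := by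
    rw [← setLIntegral_univ, ← withDensity_apply _ .univ,
      ← hm.productMixture_eq_withDensity hac fun i => (hq i).1,
      productMixture_univ fun i => hq i]
  have hint : Integrable (fun ω => ∏ i, inputRatio m x₀ i (q i) ω) (m x₀) :=
    (lintegral_ofReal_ne_top_iff_integrable hmeas hnonneg).1 (by simp [hmass])
  have hone : ∫ ω, ∏ i, inputRatio m x₀ i (q i) ω ∂m x₀ = 1 := by
    rw [integral_eq_lintegral_of_nonneg_ae hnonneg hmeas, hmass, ENNReal.toReal_one]
  have haff := one_sub_sqrt_le_integral_min_one_prod (r := fun i => inputRatio m x₀ i (q i))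
    (fun i => integrable_inputRatio x₀ i (q i)) (fun i => integral_inputRatio hac i (hq i).2) hr
    hint hone
  have hmin : Integrable (fun ω => min 1 (∏ i, inputRatio m x₀ i (q i) ω)) (m x₀) :=
    (integrable_const 1).inf hint
  refine (ENNReal.ofReal_le_ofReal haff).trans_eq ?_
  rw [ofReal_integral_eq_lintegral_ofReal hmin
    (hnonneg.mono fun ω hω => le_min zero_le_one hω)]
  simp only [ENNReal.ofReal_min, ENNReal.ofReal_one]

theorem IsRectangular.edist_mul_le_lintegral_add {X : Type*} [PseudoEMetricSpace X]
    [MeasurableSpace X] [OpensMeasurableSpace X] (hm : IsRectangular m)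
    [∀ x, IsProbabilityMeasure (m x)] {E : ℝ} (hE : 1 ≤ E)
    (hpriv : ∀ x i a, m x ≤ ENNReal.ofReal E • m (Function.update x i a)) (x₀ : ι → A)
    {q : ι → A → ℝ} (hq : ∀ i, q i ∈ stdSimplex ℝ A) {f : Ω → X} (hf : Measurable f) (u v : X) :
    edist u v * ENNReal.ofReal (1 - √(2 * ∑ i, ((1 - q i (x₀ i)) * (E - 1)) ^ 2)) ≤
      ∫⁻ ω, edist (f ω) u ∂m x₀ + ∫⁻ ω, edist (f ω) v ∂productMixture m q := by
  have hac := fun x => absolutelyContinuous_of_le_smul_update hpriv x x₀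
  have hdens : Measurable fun ω => ENNReal.ofReal (∏ i, inputRatio m x₀ i (q i) ω) :=
    (Finset.measurable_fun_prod _ fun i _ => measurable_inputRatio x₀ i (q i)).ennreal_ofReal
  rw [hm.productMixture_eq_withDensity hac fun i => (hq i).1]
  exact (mul_le_mul_right (hm.ofReal_one_sub_sqrt_le_lintegral_min_one hE hpriv x₀ hq) _).trans
    (edist_mul_lintegral_min_one_le (m x₀) hdens hf u v)

end Mixture

/-! ### Transcripts of protocols -/

namespace LocalProtocol

variable {n k : ℕ} {Y : Type*} [MeasurableSpace Y] (P : LocalProtocol n k Y)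

theorem step_of_speaker_eq_none {x : Fin n → Fin k} {t : ℕ} {h : Fin t → Y}
    (hh : P.speaker t h = none) : P.step x t h = P.server t h := by
  change (match P.speaker t h with
    | none => P.server t h
    | some i => P.user i t (x i) h) = _
  rw [hh]

theorem step_of_speaker_eq_some {x : Fin n → Fin k} {t : ℕ} {h : Fin t → Y} {i : Fin n}
    (hh : P.speaker t h = some i) : P.step x t h = P.user i t (x i) h := by
  change (match P.speaker t h with
    | none => P.server t h
    | some i => P.user i t (x i) h) = _
  rw [hh]

instance isMarkovKernel_step (x : Fin n → Fin k) (t : ℕ) : IsMarkovKernel (P.step x t) where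
  isProbabilityMeasure h := by
    rcases hh : P.speaker t h with _ | i
    · rw [step_of_speaker_eq_none P hh]
      exact (P.isMarkovKernel_server t).isProbabilityMeasure h
    · rw [step_of_speaker_eq_some P hh]
      exact (P.isMarkovKernel_user i t (x i)).isProbabilityMeasure h

/-- Appending a last message to a list of messages, as a measurable equivalence. -/
def snocEquiv (Y : Type*) [MeasurableSpace Y] (t : ℕ) : (Fin t → Y) × Y ≃ᵐ (Fin (t + 1) → Y) :=
  MeasurableEquiv.prodComm.trans (MeasurableEquiv.piFinSuccAbove (fun _ => Y) (Fin.last t)).symm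

theorem prefixLaw_succ (x : Fin n → Fin k) (t : ℕ) :
    P.prefixLaw x (t + 1) = (P.prefixLaw x t ⊗ₘ P.step x t).map (snocEquiv Y t) := by
  have hsnoc : ⇑(snocEquiv Y t) = fun q => (Fin.snoc q.1 q.2 : Fin (t + 1) → Y) :=
    funext fun q => Fin.insertNth_last' q.2 q.1
  rw [hsnoc, prefixLaw]

instance isProbabilityMeasure_prefixLaw (x : Fin n → Fin k) (t : ℕ) :
    IsProbabilityMeasure (P.prefixLaw x t) := by
  induction t with
  | zero => exact Measure.dirac.isProbabilityMeasure
  | succ t ih =>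
    rw [prefixLaw_succ]
    exact Measure.isProbabilityMeasure_map (snocEquiv Y t).measurable.aemeasurable

instance isProbabilityMeasure_transcriptLaw (x : Fin n → Fin k) :
    IsProbabilityMeasure (P.transcriptLaw x) :=
  P.isProbabilityMeasure_prefixLaw x P.rounds

theorem isRectangular_compProd_step (t : ℕ) (μ : Measure (Fin t → Y)) [IsFiniteMeasure μ] :
    IsRectangular fun x => μ ⊗ₘ P.step x t := by
  have := P.isMarkovKernel_server t
  have := fun i => P.isMarkovKernel_user i t
  let _ : MeasurableSpace (Option (Fin n)) := ⊤
  have hspeaker : Measurable fun q : (Fin t → Y) × Y => P.speaker t q.1 :=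
    (measurable_to_countable' fun o => P.measurableSet_speaker t o).comp measurable_fst
  refine IsRectangular.of_restrict_fiber hspeaker
    (m' := fun o x => o.elim (μ ⊗ₘ P.server t) fun i => μ ⊗ₘ P.user i t (x i))
    (fun o => ?_) fun o x => ?_
  · cases o with
    | none => exact .const (μ ⊗ₘ P.server t)
    | some i => exact .of_apply (fun a => μ ⊗ₘ P.user i t a) i
  · cases o with
    | none =>
      exact restrict_compProd_congr μ (P.measurableSet_speaker t none)
        fun h hh => P.step_of_speaker_eq_none hh
    | some i =>
      exact restrict_compProd_congr μ (P.measurableSet_speaker t (some i))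
        fun h hh => P.step_of_speaker_eq_some hh

theorem isRectangular_prefixLaw (t : ℕ) : IsRectangular fun x => P.prefixLaw x t := by
  induction t with
  | zero => exact .const (Measure.dirac Fin.elim0)
  | succ t ih =>
    obtain ⟨μ, F, hμ, hF, hmF⟩ := ih
    beta_reduce at hmF
    have hcomp : ∀ x, P.prefixLaw x t ⊗ₘ P.step x t =
        (μ ⊗ₘ P.step x t).withDensity fun q => ∏ i, F i (x i) q.1 := fun x => by
      rw [hmF, withDensity_compProd_left _ _ (Finset.measurable_fun_prod _ fun i _ => hF i (x i))]
    simp only [prefixLaw_succ, hcomp]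
    exact ((P.isRectangular_compProd_step t μ).withDensity_prod
      fun i a => (hF i a).comp measurable_fst).map (snocEquiv Y t)

theorem isRectangular_transcriptLaw : IsRectangular P.transcriptLaw :=
  P.isRectangular_prefixLaw P.rounds

variable {P}

theorem IsLDP.transcriptLaw_le {α : ℝ} (hP : P.IsLDP α 0) (x : Fin n → Fin k) (i : Fin n)
    (a : Fin k) : P.transcriptLaw x ≤
      ENNReal.ofReal (Real.exp α) • P.transcriptLaw (Function.update x i a) :=
  Measure.le_iff.2 fun O hO => by simpa using hP x i a O hO

end LocalProtocol

theorem expectedError_eq_lintegral {n k : ℕ} {Y : Type*} [MeasurableSpace Y]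
    (P : LocalProtocol n k Y) (est : (Fin P.rounds → Y) → ℝ) (p : Fin k → ℝ) :
    expectedError P est p =
      ∫⁻ h, edist (est h) (collisionProb p) ∂productMixture P.transcriptLaw fun _ => p := by
  simp only [lintegral_productMixture, edist_dist, Real.dist_eq]
  rfl

theorem LocalProtocol.IsLDP.edist_mul_le_expectedError_add {n k : ℕ} {Y : Type*}
    [MeasurableSpace Y] {P : LocalProtocol n k Y} {α : ℝ} (hα : 0 ≤ α) (hP : P.IsLDP α 0)
    {est : (Fin P.rounds → Y) → ℝ} (hest : Measurable est) (a₀ : Fin k) {q : Fin k → ℝ}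
    (hq : q ∈ stdSimplex ℝ (Fin k)) :
    edist (collisionProb (Pi.single a₀ 1 : Fin k → ℝ)) (collisionProb q) *
        ENNReal.ofReal (1 - √(2 * (n * ((1 - q a₀) * (Real.exp α - 1)) ^ 2))) ≤
      expectedError P est (Pi.single a₀ 1) + expectedError P est q := by
  have h := P.isRectangular_transcriptLaw.edist_mul_le_lintegral_add (Real.one_le_exp hα)
    hP.transcriptLaw_le (fun _ => a₀) (fun _ => hq) hest
    (collisionProb (Pi.single a₀ 1 : Fin k → ℝ)) (collisionProb q)
  simpa only [expectedError_eq_lintegral, productMixture_single (fun _ : Fin n => a₀),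
    Finset.sum_const, Finset.card_univ, Fintype.card_fin, nsmul_eq_mul] using h

/-! ### Collision probability -/

section Collision

variable {k : ℕ}

theorem collisionProb_single (a₀ : Fin k) : collisionProb (Pi.single a₀ 1 : Fin k → ℝ) = 1 := by
  simp [collisionProb, Pi.single_apply]

theorem continuous_collisionProb : Continuous (collisionProb (k := k)) :=
  continuous_finsetSum _ fun a _ => (continuous_apply a).pow 2

theorem collisionProb_le_of_forall_le {q : Fin k → ℝ} (hq : q ∈ stdSimplex ℝ (Fin k)) {a₀ : Fin k}
    (hmax : ∀ a, q a ≤ q a₀) : collisionProb q ≤ q a₀ := by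
  calc collisionProb q ≤ ∑ a, q a * q a₀ := Finset.sum_le_sum fun a _ => by
        rw [sq]
        exact mul_le_mul_of_nonneg_left (hmax a) (hq.1 a)
    _ = q a₀ := by rw [← Finset.sum_mul, hq.2, one_mul]

theorem exists_collisionProb_eq (a₀ : Fin k) {c : ℝ} (hc : c ∈ Set.Icc (1 / (k : ℝ)) 1) :
    ∃ q ∈ stdSimplex ℝ (Fin k), collisionProb q = c ∧ c ≤ q a₀ := by
  have hk : (0 : ℝ) < k := by exact_mod_cast a₀.pos
  let uniform : Fin k → ℝ := fun _ => 1 / k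
  have hunif : uniform ∈ stdSimplex ℝ (Fin k) :=
    ⟨fun _ => by positivity, by simp [uniform, hk.ne']⟩
  let q : ℝ → Fin k → ℝ := AffineMap.lineMap (Pi.single a₀ 1) uniform
  have hq0 : collisionProb (q 0) = 1 := by
    simp only [q, AffineMap.lineMap_apply_zero, collisionProb_single]
  have hq1 : collisionProb (q 1) = 1 / k := by
    simp only [q, AffineMap.lineMap_apply_one, collisionProb, uniform, Finset.sum_const,
      Finset.card_univ, Fintype.card_fin, nsmul_eq_mul]
    field_simp
  have hcont : Continuous fun t => collisionProb (q t) :=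
    continuous_collisionProb.comp AffineMap.lineMap_continuous
  obtain ⟨t, ht, rfl⟩ : c ∈ (fun t => collisionProb (q t)) '' Set.Icc 0 1 := by
    refine intermediate_value_Icc' zero_le_one hcont.continuousOn ?_
    rwa [hq0, hq1]
  have hqt : q t ∈ stdSimplex ℝ (Fin k) :=
    (convex_stdSimplex ℝ (Fin k)).lineMap_mem (single_mem_stdSimplex ℝ a₀) hunif ht
  refine ⟨q t, hqt, rfl, collisionProb_le_of_forall_le hqt fun a => ?_⟩
  have hsingle : (Pi.single a₀ 1 : Fin k → ℝ) a ≤ (Pi.single a₀ 1 : Fin k → ℝ) a₀ := by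
    rw [Pi.single_eq_same, Pi.single_apply]
    split_ifs <;> norm_num
  simp only [q, AffineMap.lineMap_apply_module, Pi.add_apply, Pi.smul_apply, smul_eq_mul, uniform]
  gcongr
  linarith [ht.2]

end Collision

theorem sq_exp_sub_one_le {α : ℝ} (hα : 0 ≤ α) (hα' : α ≤ 2 / 3) :
    (Real.exp α - 1) ^ 2 ≤ 9 * α ^ 2 := by
  have hexp := Real.exp_bound_div_one_sub_of_interval hα (by linarith)
  have hdiv : 1 / (1 - α) ≤ 1 + 3 * α := by
    rw [div_le_iff₀ (by linarith)]
    nlinarith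
  calc (Real.exp α - 1) ^ 2 ≤ (3 * α) ^ 2 := by
        gcongr
        · exact sub_nonneg.2 (Real.one_le_exp hα)
        · linarith
    _ = 9 * α ^ 2 := by ring

theorem theorem3_general {θ : ℝ} (hθ0 : 0 < θ) (hθ1 : θ < 1) {k n : ℕ} {α ε : ℝ} (hk : 0 < k)
    (hα : 0 ≤ α) (hε : 0 ≤ ε) (hεk : ε ≤ θ * ((1 - 1 / (k : ℝ)) / 2))
    (hn : n * ((Real.exp α - 1) ^ 2 * ε ^ 2) ≤ θ ^ 2 * (1 - θ) ^ 2 / 8)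
    {Y : Type*} [MeasurableSpace Y] {P : LocalProtocol n k Y} (hP : P.IsLDP α 0)
    {est : (Fin P.rounds → Y) → ℝ} (hest : Measurable est) :
    ∃ p ∈ stdSimplex ℝ (Fin k), ENNReal.ofReal ε ≤ expectedError P est p := by
  let a₀ : Fin k := ⟨0, hk⟩
  have hγ : 2 * ε / θ ≤ 1 - 1 / k := by rw [div_le_iff₀ hθ0]; linarith
  obtain ⟨q, hq, hC, hqa₀⟩ := exists_collisionProb_eq a₀ (c := 1 - 2 * ε / θ)
    ⟨by linarith, sub_le_self 1 (by positivity)⟩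
  have hq1 : q a₀ ≤ 1 := hq.2 ▸ Finset.single_le_sum (fun a _ => hq.1 a) (Finset.mem_univ a₀)
  have hE : 0 ≤ Real.exp α - 1 := sub_nonneg.2 (Real.one_le_exp hα)
  have hsqrt : √(2 * (n * ((1 - q a₀) * (Real.exp α - 1)) ^ 2)) ≤ 1 - θ := by
    refine Real.sqrt_le_iff.2 ⟨by linarith, ?_⟩
    calc 2 * (n * ((1 - q a₀) * (Real.exp α - 1)) ^ 2)
        ≤ 2 * (n * (2 * ε / θ * (Real.exp α - 1)) ^ 2) := by gcongr; linarith
      _ = 8 / θ ^ 2 * (n * ((Real.exp α - 1) ^ 2 * ε ^ 2)) := by ring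
      _ ≤ 8 / θ ^ 2 * (θ ^ 2 * (1 - θ) ^ 2 / 8) := by gcongr
      _ = (1 - θ) ^ 2 := by field_simp
  have hsum : ENNReal.ofReal (ε + ε) ≤
      expectedError P est (Pi.single a₀ 1) + expectedError P est q := by
    refine le_trans ?_ (hP.edist_mul_le_expectedError_add hα hest a₀ hq)
    rw [collisionProb_single, hC, edist_dist, Real.dist_eq, sub_sub_cancel,
      abs_of_nonneg (by positivity), ← ENNReal.ofReal_mul (by positivity)]
    refine ENNReal.ofReal_le_ofReal ?_
    calc ε + ε = 2 * ε / θ * θ := by field_simp; ring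
      _ ≤ 2 * ε / θ * (1 - √(2 * (n * ((1 - q a₀) * (Real.exp α - 1)) ^ 2))) := by
        gcongr; linarith
  by_contra! hlt
  rw [ENNReal.ofReal_add hε hε] at hsum
  exact hsum.not_gt (ENNReal.add_lt_add (hlt _ (single_mem_stdSimplex ℝ a₀)) (hlt q hq))

theorem theorem3 (θ : ℝ) (hθ0 : 0 < θ) (hθ1 : θ < 1) :
    ∃ c : ℝ, 0 < c ∧
      ∀ (k n : ℕ) (α ε : ℝ), 2 ≤ k → 0 ≤ α → α ≤ 23 / 35 →
        0 < ε → ε ≤ θ * ((1 - 1 / (k : ℝ)) / 2) →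
        (n : ℝ) * (α ^ 2 * ε ^ 2) ≤ c →
        ∀ (Y : Type*) [MeasurableSpace Y] [StandardBorelSpace Y] (P : LocalProtocol n k Y),
          P.IsLDP α 0 →
          ∀ est : (Fin P.rounds → Y) → ℝ, Measurable est →
            ∃ p ∈ stdSimplex ℝ (Fin k), ENNReal.ofReal ε ≤ expectedError P est p := by
  refine ⟨θ ^ 2 * (1 - θ) ^ 2 / 72, by have := sub_pos.2 hθ1; positivity, ?_⟩
  intro k n α ε hk hα hα' hε hεk hn Y _ _ P hP est hest
  refine theorem3_general hθ0 hθ1 (by omega) hα hε.le hεk ?_ hP hest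
  have hexp : n * ((Real.exp α - 1) ^ 2 * ε ^ 2) ≤ n * (9 * α ^ 2 * ε ^ 2) := by
    gcongr
    exact sq_exp_sub_one_le hα (by linarith)
  linarith
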